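/- For $n\in\mathbb{Z}_+=\{0,1,2,\dots\}$ let $\mathrm{L}_n(\xi)=\sum_{\ell=0}^n(-1)^\ell\binom{n}{\ell}\frac{\xi^\ell}{\ell!}$ be the Laguerre polynomials, which are orthonormal with respect to the Laguerre weight $w(\xi)=\mathrm{e}^{-\xi}\chi_{[0,\infty)}(\xi)$, and let $$\varphi_n^{\langle1\rangle}(x)=\frac{\mathrm{i}^n}{\sqrt{2\pi}}\int_{-\infty}^\infty \mathrm{e}^{\mathrm{i}x\xi}\,\mathrm{L}_n(\xi)\sqrt{\frac{w(\xi)}{1+\xi^2}}\,\mathrm{d}\xi,\qquad x\in\mathbb{R},$$ be the Sobolev–Laguerre functions of the first kind. Let $g(z)=\mathrm{Y}_0(z)-\mathbf{H}_0(z)$ (principal branches), where $$\mathrm{Y}_0(z)=\frac{2}{\pi}\,\frac{\partial \mathrm{J}_\nu(z)}{\partial\nu}\Big|_{\nu=0},\qquad \mathrm{J}_\nu(z)=\left(\frac z2\right)^{\nu}\sum_{k=0}^\infty\frac{(-1)^k(z^2/4)^k}{k!\,\Gamma(\nu+k+1)},$$ is the Bessel function of the second kind (Weber function) and $$\mathbf{H}_0(z)=\frac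 z2\sum_{k=0}^\infty\frac{(-1)^k(z/2)^{2k}}{\Gamma(k+\frac32)^2}$$ is the Struve function of order $0$. Then for all $x\in\mathbb{R}$ and $t\in\mathbb{C}$ both series below converge (absolutely) and $$\sum_{n=0}^\infty\frac{\varphi_n^{\langle1\rangle}(x)}{n!}t^n=-\frac{\sqrt{2\pi}}{4}\,\mathrm{e}^{\mathrm{i}t}\sum_{\ell=0}^\infty\frac{(\mathrm{i}t)^\ell}{(\ell!)^2}\,g^{(\ell)}\!\left(\tfrac12-\mathrm{i}x\right),$$ where $g^{(\ell)}$ is the $\ell$-th complex derivative of $g$. -/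

import Mathlib

noncomputable section

namespace SobolevLaguerre

open Polynomial MeasureTheory

/-! ### Orthonormal polynomial systems and Sobolev cascades of the first kind -/

/-- A system of real polynomials `p_n`, with `p_n` of degree exactly `n`, orthonormal with respect
to the weight function `w` on the real line. -/
structure OrthonormalPolynomials (w : ℝ → ℝ) where
  /-- the `n`-th polynomial of the system -/
  poly : ℕ → ℝ[X]
  natDegree_poly : ∀ n, (poly n).natDegree = n
  integrable_mul : ∀ m n, Integrable fun ξ : ℝ => (poly m).eval ξ * (poly n).eval ξ * w ξ
  orthonormal : ∀ m n,
    ∫ ξ : ℝ, (poly m).eval ξ * (poly n).eval ξ * w ξ = if m = n then 1 else 0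

/-- The functions `φ_n^{⟨s⟩}` of the Sobolev cascade of the first kind for the weight `w`:
`φ_n^{⟨s⟩}(x) = i^n / √(2π) * ∫ e^{i x ξ} p_n(ξ) √(w(ξ) / ∑_{k=0}^s ξ^{2k}) dξ`. -/
def firstKind {w : ℝ → ℝ} (P : OrthonormalPolynomials w) (s n : ℕ) (x : ℝ) : ℂ :=
  Complex.I ^ n / (√(2 * Real.pi) : ℝ) *
    ∫ ξ : ℝ, Complex.exp (Complex.I * x * ξ) * ((P.poly n).eval ξ : ℝ) *
      (√(w ξ / ∑ k ∈ Finset.range (s + 1), ξ ^ (2 * k)) : ℝ)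

/-! ### The Laguerre weight and the Laguerre polynomials -/

/-- The Laguerre weight `e^{-ξ} χ_{[0,∞)}(ξ)`. -/
def laguerreWeight : ℝ → ℝ :=
  Set.indicator (Set.Ici 0) fun ξ => Real.exp (-ξ)

/-- The classical Laguerre polynomial
`L_n(ξ) = ∑_{ℓ=0}^n (-1)^ℓ (n choose ℓ) ξ^ℓ / ℓ!`. -/
def laguerrePoly (n : ℕ) : ℝ[X] :=
  ∑ l ∈ Finset.range (n + 1), C ((-1) ^ l * (n.choose l : ℝ) / (l.factorial : ℝ)) * X ^ l

theorem laguerrePoly_coeff (n l : ℕ) :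
    (laguerrePoly n).coeff l = (-1) ^ l * (n.choose l : ℝ) / (l.factorial : ℝ) := by
  simp only [laguerrePoly, finsetSum_coeff, coeff_C_mul, coeff_X_pow, mul_ite, mul_one, mul_zero,
    Finset.sum_ite_eq, Finset.mem_range]
  split_ifs with h
  · rfl
  · simp [Nat.choose_eq_zero_of_lt (by omega : n < l)]

theorem laguerrePoly_natDegree (n : ℕ) : (laguerrePoly n).natDegree = n := by
  refine natDegree_eq_of_le_of_coeff_ne_zero ?_ ?_
  · refine natDegree_le_iff_coeff_eq_zero.2 fun l hl => ?_
    simp [laguerrePoly_coeff, Nat.choose_eq_zero_of_lt hl]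
  · rw [laguerrePoly_coeff]
    simp [Nat.factorial_ne_zero]

theorem eval_mul_laguerreWeight (q : ℝ[X]) :
    (fun ξ : ℝ => q.eval ξ * laguerreWeight ξ) =
      Set.indicator (Set.Ici 0) fun ξ => q.eval ξ * Real.exp (-ξ) := by
  funext ξ
  by_cases h : ξ ∈ Set.Ici (0 : ℝ) <;> simp [laguerreWeight, h]

theorem pow_integrableOn (k : ℕ) :
    IntegrableOn (fun ξ : ℝ => ξ ^ k * Real.exp (-ξ)) (Set.Ioi 0) := by
  have h := Real.GammaIntegral_convergent (s := (k : ℝ) + 1) (by positivity)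
  refine h.congr_fun (fun ξ _ => ?_) measurableSet_Ioi
  simp [mul_comm]

theorem integral_pow (k : ℕ) :
    ∫ ξ in Set.Ioi (0 : ℝ), ξ ^ k * Real.exp (-ξ) = k.factorial := by
  rw [← Real.Gamma_nat_eq_factorial, Real.Gamma_eq_integral (by positivity)]
  refine setIntegral_congr_fun measurableSet_Ioi (fun ξ _ => ?_)
  simp [mul_comm]

theorem poly_integrable (q : ℝ[X]) : Integrable fun ξ : ℝ => q.eval ξ * laguerreWeight ξ := by
  rw [eval_mul_laguerreWeight, integrable_indicator_iff measurableSet_Ici,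
    integrableOn_Ici_iff_integrableOn_Ioi]
  simp only [eval_eq_sum_range, Finset.sum_mul, mul_assoc]
  exact integrable_finsetSum _ fun i _ => (pow_integrableOn i).const_mul _

/-- Integration against the Laguerre weight, as a linear functional on polynomials. -/
def laguerreFunctional : ℝ[X] →ₗ[ℝ] ℝ where
  toFun q := ∫ ξ : ℝ, q.eval ξ * laguerreWeight ξ
  map_add' p q := by
    simp only [eval_add, add_mul]
    exact integral_add (poly_integrable p) (poly_integrable q)
  map_smul' c q := by
    simp only [eval_smul, smul_eq_mul, mul_assoc, RingHom.id_apply]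
    exact integral_const_mul _ _

theorem laguerreFunctional_X_pow (k : ℕ) : laguerreFunctional (X ^ k) = k.factorial := by
  change ∫ ξ : ℝ, (X ^ k : ℝ[X]).eval ξ * laguerreWeight ξ = _
  rw [eval_mul_laguerreWeight, integral_indicator measurableSet_Ici,
    integral_Ici_eq_integral_Ioi]
  simpa using integral_pow k

theorem shiftedPochhammer_eval (k j : ℕ) :
    ((ascPochhammer ℝ k).comp (X + C 1)).eval (j : ℝ) * (j.factorial : ℝ) =
      ((j + k).factorial : ℝ) := by
  have h := Nat.factorial_mul_ascFactorial j k
  rw [← ascPochhammer_nat_eq_ascFactorial] at h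
  rw [← h]
  simp only [eval_comp, eval_add, eval_X, eval_C]
  push_cast
  rw [mul_comm]

theorem laguerreFunctional_mul_X_pow (n k : ℕ) :
    laguerreFunctional (laguerrePoly n * X ^ k) =
      (-1) ^ n * (fwdDiff 1)^[n] ((ascPochhammer ℝ k).comp (X + C 1)).eval 0 := by
  rw [fwdDiff_iter_eq_sum_shift, laguerrePoly, Finset.sum_mul, map_sum, Finset.mul_sum]
  refine Finset.sum_congr rfl fun j hj => ?_
  have hj' : j ≤ n := Nat.lt_succ_iff.1 (Finset.mem_range.1 hj)
  have e : C ((-1) ^ j * (n.choose j : ℝ) / (j.factorial : ℝ)) * X ^ j * X ^ k =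
      ((-1) ^ j * (n.choose j : ℝ) / (j.factorial : ℝ)) • (X ^ (j + k) : ℝ[X]) := by
    rw [smul_eq_C_mul, pow_add, mul_assoc]
  rw [e, map_smul, laguerreFunctional_X_pow, ← shiftedPochhammer_eval, smul_eq_mul]
  have hf : (j.factorial : ℝ) ≠ 0 := by exact_mod_cast j.factorial_ne_zero
  have hs : (-1 : ℝ) ^ n * (-1) ^ (n - j) = (-1) ^ j := by
    obtain ⟨d, rfl⟩ := Nat.exists_eq_add_of_le hj'
    rw [Nat.add_sub_cancel_left, pow_add, mul_assoc, ← mul_pow]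
    simp
  simp only [zero_add, nsmul_eq_mul, mul_one, zsmul_eq_mul]
  push_cast
  rw [← mul_assoc ((-1 : ℝ) ^ n), ← mul_assoc ((-1 : ℝ) ^ n), hs]
  field_simp

theorem shiftedPochhammer_natDegree (k : ℕ) :
    ((ascPochhammer ℝ k).comp (X + C 1)).natDegree = k := by
  rw [natDegree_comp, natDegree_X_add_C, ascPochhammer_natDegree, mul_one]

theorem laguerreFunctional_of_lt {n k : ℕ} (h : k < n) :
    laguerreFunctional (laguerrePoly n * X ^ k) = 0 := by
  rw [laguerreFunctional_mul_X_pow, fwdDiff_iter_eq_zero_of_degree_lt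
    (by rwa [shiftedPochhammer_natDegree])]
  simp

theorem laguerreFunctional_self (n : ℕ) :
    laguerreFunctional (laguerrePoly n * X ^ n) = (-1) ^ n * (n.factorial : ℝ) := by
  have h := fwdDiff_iter_degree_eq_factorial ((ascPochhammer ℝ n).comp (X + C 1))
  have hm : ((ascPochhammer ℝ n).comp (X + C 1)).leadingCoeff = 1 :=
    ((monic_ascPochhammer ℝ n).comp_X_add_C 1)
  rw [shiftedPochhammer_natDegree, hm] at h
  rw [laguerreFunctional_mul_X_pow, h]
  simp

theorem laguerre_orthonormal_of_le {m n : ℕ} (h : m ≤ n) :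
    laguerreFunctional (laguerrePoly n * laguerrePoly m) = if m = n then 1 else 0 := by
  rw [(laguerrePoly m).as_sum_range_C_mul_X_pow, laguerrePoly_natDegree, Finset.mul_sum, map_sum,
    Finset.sum_range_succ]
  have e : ∀ l, laguerreFunctional (laguerrePoly n * (C ((laguerrePoly m).coeff l) * X ^ l)) =
      (laguerrePoly m).coeff l * laguerreFunctional (laguerrePoly n * X ^ l) := fun l => by
    rw [mul_left_comm, ← smul_eq_C_mul, map_smul, smul_eq_mul]
  simp only [e]
  rw [Finset.sum_eq_zero fun l hl => by
    rw [laguerreFunctional_of_lt ((Finset.mem_range.1 hl).trans_le h), mul_zero], zero_add]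
  split_ifs with hmn
  · subst hmn
    rw [laguerreFunctional_self, laguerrePoly_coeff, Nat.choose_self]
    have hf : (m.factorial : ℝ) ≠ 0 := by exact_mod_cast m.factorial_ne_zero
    have hs : (-1 : ℝ) ^ m * (-1) ^ m = 1 := by rw [← mul_pow]; simp
    field_simp
    rw [pow_two, hs, Nat.cast_one, one_mul]
  · rw [laguerreFunctional_of_lt (lt_of_le_of_ne h hmn), mul_zero]

/-- The Laguerre polynomials, as the orthonormal polynomial system of the Laguerre weight. -/
def laguerreSystem : OrthonormalPolynomials laguerreWeight where
  poly := laguerrePoly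
  natDegree_poly := laguerrePoly_natDegree
  integrable_mul m n := by
    simpa only [eval_mul] using poly_integrable (laguerrePoly m * laguerrePoly n)
  orthonormal m n := by
    have key : laguerreFunctional (laguerrePoly m * laguerrePoly n) = if m = n then 1 else 0 := by
      rcases le_total m n with h | h
      · rw [mul_comm, laguerre_orthonormal_of_le h]
      · rw [laguerre_orthonormal_of_le h]
        simp only [eq_comm]
    simpa only [laguerreFunctional, LinearMap.coe_mk, AddHom.coe_mk, eval_mul] using key

/-- The Sobolev–Laguerre functions of the first kind `φ_n^{⟨1⟩}`, `n ≥ 0`. -/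
def sobolevLaguerre (n : ℕ) (x : ℝ) : ℂ :=
  firstKind laguerreSystem 1 n x

/-! ### Bessel and Struve functions (principal branches) -/

/-- The Bessel function of the first kind
`J_ν(z) = (z/2)^ν ∑_k (-1)^k (z²/4)^k / (k! Γ(ν+k+1))`.
The reciprocal `1/Γ` takes its correct value `0` at the poles of `Γ`. -/
def besselJ (ν z : ℂ) : ℂ :=
  (z / 2) ^ ν * ∑' k : ℕ,
    (-1) ^ k * (z ^ 2 / 4) ^ k / ((k.factorial : ℂ) * Complex.Gamma (ν + k + 1))

/-- The Bessel function of the second kind (Weber function) of integer order `n`,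
`Y_n(z) = (1/π) ∂J_ν(z)/∂ν |_{ν=n} + ((-1)^n/π) ∂J_ν(z)/∂ν |_{ν=-n}`. -/
def besselY (n : ℕ) (z : ℂ) : ℂ :=
  1 / Real.pi * deriv (fun ν : ℂ => besselJ ν z) n +
    (-1) ^ n / Real.pi * deriv (fun ν : ℂ => besselJ ν z) (-n)

/-- The Struve function
`H_ν(z) = (z/2)^{ν+1} ∑_k (-1)^k (z/2)^{2k} / (Γ(k+3/2) Γ(k+ν+3/2))`. -/
def struveH (ν z : ℂ) : ℂ :=
  (z / 2) ^ (ν + 1) * ∑' k : ℕ,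
    (-1) ^ k * (z / 2) ^ (2 * k) / (Complex.Gamma (k + 3 / 2) * Complex.Gamma (k + ν + 3 / 2))

/-- `g = Y_0 - H_0`. -/
def weberStruve (z : ℂ) : ℂ :=
  besselY 0 z - struveH 0 z

end SobolevLaguerre

end

/-! Put F(z) = ∫_0^∞ e^{-zξ} / √(1+ξ²) dξ for Re z > 0; `laplaceMoment l` is its l-th derivative. In
the integral for φ_n the square root of the weight contributes e^{-ξ/2}, and the signs (-1)^l of the
Laguerre polynomial turn ξ^l into (-ξ)^l. So φ_n(x) = i^n/√(2π) ∑_l (n choose l)/l! · F^{(l)}(1/2 -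
ix) (`sobolevLaguerre_eq_sum`). After division by n!, the generating function is the Cauchy product
of e^{it} with ∑_l (it)^l/(l!)² F^{(l)}(1/2 - ix); the bound |F^{(l)}(z)| ≤ l!/(Re z)^{l+1} makes
both factors absolutely convergent.

It remains to identify F = -(π/2)(Y_0 - H_0) (`weberStruve_eq`). Integration by parts gives zF'' +
F' + zF = 1. The series of Y_0 and H_0 give matching equations, so the defect D = F + (π/2)(Y_0 -
H_0) solves the homogeneous Bessel equation. Its indicial root 0 is double, so a solution behaves
like a + b log x at 0+. Here D and xD' both tend to 0: the logarithm cancels, and so does the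
constant, because (1/Γ)'(1) = -∫ log u e^{-u} du occurs in both Y_0 and F. Hence D vanishes near 0+
(`eq_zero_of_bessel_equation`), and on the half-plane by the identity theorem.

Differential equations are checked on coefficients through θ = w d/dw, which multiplies the k-th
coefficient by k; here w = z²/4, so z d/dz = 2θ. -/

namespace SobolevLaguerre

open MeasureTheory Filter Topology Set

/-! ### Entire power series -/

/-- The sum of the power series with coefficients `c`. -/
noncomputable def powerSum (c : ℕ → ℂ) (w : ℂ) : ℂ := ∑' k, c k * w ^ k

/-- The power series with coefficients `c` converges absolutely everywhere. -/
def EntireCoeff (c : ℕ → ℂ) : Prop := ∀ r : ℝ, 0 ≤ r → Summable fun k => ‖c k‖ * r ^ k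

theorem EntireCoeff.summable {c : ℕ → ℂ} (hc : EntireCoeff c) (w : ℂ) :
    Summable fun k => c k * w ^ k := by
  refine Summable.of_norm ?_
  simpa only [norm_mul, norm_pow] using hc ‖w‖ (norm_nonneg w)

theorem EntireCoeff.of_norm_le {c : ℕ → ℂ} {C R : ℝ}
    (h : ∀ k, ‖c k‖ ≤ C * (R ^ k / k.factorial)) : EntireCoeff c := by
  intro r hr
  refine Summable.of_nonneg_of_le (fun k => by positivity)
    (fun k => mul_le_mul_of_nonneg_right (h k) (pow_nonneg hr k)) ?_
  refine ((Real.summable_pow_div_factorial (R * r)).mul_left C).congr fun k => ?_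
  rw [mul_pow]
  ring

/-- Closure under the Euler operator w d/dw: the factor k ≤ 2^k is absorbed by doubling the radius.
-/
theorem EntireCoeff.natCast_mul {c : ℕ → ℂ} (hc : EntireCoeff c) :
    EntireCoeff fun k => (k : ℂ) * c k := by
  intro r hr
  refine Summable.of_nonneg_of_le (fun k => by positivity) (fun k => ?_)
    (hc (2 * r) (by positivity))
  have hk : (k : ℝ) ≤ 2 ^ k := by exact_mod_cast Nat.lt_two_pow_self.le
  rw [norm_mul, Complex.norm_natCast, mul_pow, mul_comm (k : ℝ), mul_assoc]
  gcongr

theorem EntireCoeff.add {c d : ℕ → ℂ} (hc : EntireCoeff c) (hd : EntireCoeff d) :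
    EntireCoeff fun k => c k + d k := by
  intro r hr
  refine Summable.of_nonneg_of_le (fun k => by positivity) (fun k => ?_) ((hc r hr).add (hd r hr))
  rw [← add_mul]
  gcongr
  exact norm_add_le _ _

theorem EntireCoeff.const_mul {c : ℕ → ℂ} (hc : EntireCoeff c) (a : ℂ) :
    EntireCoeff fun k => a * c k := by
  intro r hr
  simpa only [norm_mul, mul_assoc] using (hc r hr).mul_left ‖a‖

theorem EntireCoeff.succ {c : ℕ → ℂ} (hc : EntireCoeff c) : EntireCoeff fun k => c (k + 1) := by
  intro r hr
  refine Summable.of_nonneg_of_le (fun k => by positivity) (fun k => ?_)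
    ((summable_nat_add_iff 1).2 (hc (r + 1) (by positivity)))
  gcongr
  calc r ^ k ≤ (r + 1) ^ k := by gcongr; linarith
    _ ≤ (r + 1) ^ (k + 1) := pow_le_pow_right₀ (by linarith) (by omega)

theorem powerSum_add {c d : ℕ → ℂ} (hc : EntireCoeff c) (hd : EntireCoeff d) (w : ℂ) :
    powerSum (fun k => c k + d k) w = powerSum c w + powerSum d w := by
  rw [powerSum, powerSum, powerSum, ← (hc.summable w).tsum_add (hd.summable w)]
  simp only [add_mul]

theorem powerSum_const_mul (c : ℕ → ℂ) (a w : ℂ) :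
    powerSum (fun k => a * c k) w = a * powerSum c w := by
  rw [powerSum, powerSum, ← tsum_mul_left]
  simp only [mul_assoc]

theorem powerSum_zero (c : ℕ → ℂ) : powerSum c 0 = c 0 := by
  rw [powerSum, tsum_eq_single 0 fun k hk => by simp [hk]]
  simp

theorem powerSum_eq_add_mul {c : ℕ → ℂ} (hc : EntireCoeff c) (w : ℂ) :
    powerSum c w = c 0 + w * powerSum (fun k => c (k + 1)) w := by
  rw [powerSum, (hc.summable w).tsum_eq_zero_add, powerSum, ← tsum_mul_left]
  simp only [pow_zero, mul_one]
  congr 2 with k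
  ring

theorem EntireCoeff.differentiable {c : ℕ → ℂ} (hc : EntireCoeff c) :
    Differentiable ℂ (powerSum c) := by
  intro w
  refine (Complex.differentiableOn_tsum_of_summable_norm (U := Metric.ball 0 (‖w‖ + 1))
    (hc (‖w‖ + 1) (by positivity)) (fun k => by fun_prop) Metric.isOpen_ball
    fun k v hv => ?_).differentiableAt (Metric.isOpen_ball.mem_nhds (by simp))
  rw [norm_mul, norm_pow]
  gcongr
  exact (mem_ball_zero_iff.1 hv).le

/-- Writing the derivative as the Euler operator over w avoids an index shift, at the price of w ≠
0. -/
theorem EntireCoeff.hasDerivAt {c : ℕ → ℂ} (hc : EntireCoeff c) {w : ℂ} (hw : w ≠ 0) :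
    HasDerivAt (powerSum c) (powerSum (fun k => (k : ℂ) * c k) w / w) w := by
  have h := Complex.hasSum_deriv_of_summable_norm (U := Metric.ball 0 (‖w‖ + 1)) (z := w)
    (F := fun k v => c k * v ^ k)
    (hc (‖w‖ + 1) (by positivity)) (fun k => by fun_prop) Metric.isOpen_ball
    (fun k v hv => by
      rw [norm_mul, norm_pow]
      gcongr
      exact (mem_ball_zero_iff.1 hv).le) (by simp)
  have e : powerSum (fun k => (k : ℂ) * c k) w / w = deriv (powerSum c) w := by
    change _ = deriv (fun v => ∑' k, c k * v ^ k) w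
    rw [← h.tsum_eq, powerSum, ← tsum_div_const]
    congr 1 with k
    rw [deriv_const_mul_field, deriv_pow_field]
    rcases k with - | k
    · simp
    · rw [Nat.add_sub_cancel]
      field_simp
      ring
  rw [e]
  exact (hc.differentiable w).hasDerivAt

theorem EntireCoeff.hasDerivAt_sq_div_four {c : ℕ → ℂ} (hc : EntireCoeff c) {z : ℂ} (hz : z ≠ 0) :
    HasDerivAt (fun z => powerSum c (z ^ 2 / 4))
      (2 * powerSum (fun k => (k : ℂ) * c k) (z ^ 2 / 4) / z) z := by
  have h := (hc.hasDerivAt (w := z ^ 2 / 4) (div_ne_zero (pow_ne_zero 2 hz) (by norm_num))).comp z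
    (((hasDerivAt_id z).pow 2).div_const 4)
  refine h.congr_deriv ?_
  simp
  field_simp

/-! ### Coefficients of the Bessel and Struve functions of order zero -/

/-- Coefficients of `J_0` as a power series in `z² / 4`. -/
noncomputable def besselCoeff (k : ℕ) : ℂ := (-1) ^ k / ((k.factorial : ℂ) * k.factorial)

/-- Derivative of the reciprocal Gamma function at `k + 1`. -/
noncomputable def recipGammaDeriv (k : ℕ) : ℂ := deriv (fun s => (Complex.Gamma s)⁻¹) (k + 1)

/-- Coefficients of the non-logarithmic part of `π Y_0 / 2` as a power series in `z² / 4`. -/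
noncomputable def weberCoeff (k : ℕ) : ℂ := (-1) ^ k / (k.factorial : ℂ) * recipGammaDeriv k

/-- Coefficients of `H_0 / (z / 2)` as a power series in `z² / 4`. -/
noncomputable def struveCoeff (k : ℕ) : ℂ :=
  (-1) ^ k / (Complex.Gamma (k + 3 / 2) * Complex.Gamma (k + 3 / 2))

/-- Differentiate 1/Γ(s) = s · 1/Γ(s+1) at s = k + 1. This replaces any explicit digamma values. -/
theorem recipGammaDeriv_recurrence (k : ℕ) :
    recipGammaDeriv k = ((k + 1).factorial : ℂ)⁻¹ + (k + 1) * recipGammaDeriv (k + 1) := by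
  have hd := Complex.differentiable_one_div_Gamma
  have e : (fun s => (Complex.Gamma s)⁻¹) = fun s => s * (Complex.Gamma (s + 1))⁻¹ :=
    funext Complex.one_div_Gamma_eq_self_mul_one_div_Gamma_add_one
  have h : HasDerivAt (fun s : ℂ => s * (Complex.Gamma (s + 1))⁻¹)
      (1 * (Complex.Gamma ((k + 1 : ℂ) + 1))⁻¹ + (k + 1 : ℂ) * recipGammaDeriv (k + 1))
      (k + 1 : ℂ) := by
    refine (hasDerivAt_id _).mul ?_
    refine HasDerivAt.comp_add_const _ (1 : ℂ) (f := fun s => (Complex.Gamma s)⁻¹) ?_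
    rw [recipGammaDeriv]
    push_cast
    exact (hd _).hasDerivAt
  rw [recipGammaDeriv, e, h.deriv, one_mul]
  congr 2
  exact_mod_cast Complex.Gamma_nat_eq_factorial (k + 1)

theorem norm_recipGammaDeriv_le (k : ℕ) :
    ‖recipGammaDeriv k‖ ≤ (‖recipGammaDeriv 0‖ + 1) * 2 ^ k := by
  induction k with
  | zero => simp
  | succ k ih =>
    have hk : ((k : ℂ) + 1) ≠ 0 := by exact_mod_cast k.succ_ne_zero
    have e : recipGammaDeriv (k + 1) =
        (recipGammaDeriv k - ((k + 1).factorial : ℂ)⁻¹) / (k + 1) := by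
      rw [recipGammaDeriv_recurrence k]
      field_simp
      ring
    have hn : (1 : ℝ) ≤ ‖(k : ℂ) + 1‖ := by
      rw [show (k : ℂ) + 1 = ((k + 1 : ℕ) : ℂ) by push_cast; rfl, Complex.norm_natCast]
      simp
    have hf : ‖((k + 1).factorial : ℂ)⁻¹‖ ≤ 1 := by
      rw [norm_inv, Complex.norm_natCast]
      exact inv_le_one_of_one_le₀ (by exact_mod_cast (k + 1).factorial_pos)
    have h2 : (1 : ℝ) ≤ 2 ^ k := one_le_pow₀ (by norm_num)
    rw [e, norm_div]
    refine (div_le_self (norm_nonneg _) hn).trans ((norm_sub_le _ _).trans ?_)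
    rw [pow_succ]
    -- The `+ 1` in the constant makes the previous bound at least 1, so adding 1 at most doubles
    -- it.
    nlinarith [norm_nonneg (recipGammaDeriv 0)]

theorem entireCoeff_bessel : EntireCoeff besselCoeff := by
  refine EntireCoeff.of_norm_le (C := 1) (R := 1) fun k => ?_
  have h : (1 : ℝ) ≤ k.factorial := by exact_mod_cast k.factorial_pos
  rw [besselCoeff, norm_div, norm_mul, norm_pow, norm_neg, norm_one, one_pow, one_mul,
    Complex.norm_natCast]
  exact one_div_le_one_div_of_le (by positivity) (by nlinarith)

theorem entireCoeff_weber : EntireCoeff weberCoeff := by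
  refine EntireCoeff.of_norm_le (C := ‖recipGammaDeriv 0‖ + 1) (R := 2) fun k => ?_
  rw [weberCoeff, norm_mul, norm_div, norm_pow, norm_neg, norm_one, one_pow,
    Complex.norm_natCast, one_div_mul_eq_div, ← mul_div_assoc]
  gcongr
  exact norm_recipGammaDeriv_le k

theorem struveCoeff_recurrence (k : ℕ) :
    ((k : ℂ) + 3 / 2) ^ 2 * struveCoeff (k + 1) = -struveCoeff k := by
  have h0 : (k : ℂ) + 3 / 2 ≠ 0 := by
    intro h
    have := congrArg Complex.re h
    norm_num at this
    linarith [(k.cast_nonneg : (0 : ℝ) ≤ k)]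
  have e : Complex.Gamma (((k + 1 : ℕ) : ℂ) + 3 / 2) =
      (k + 3 / 2) * Complex.Gamma (k + 3 / 2) := by
    rw [← Complex.Gamma_add_one _ h0]
    congr 1
    push_cast
    ring
  have hg : Complex.Gamma ((k : ℂ) + 3 / 2) ≠ 0 :=
    Complex.Gamma_ne_zero_of_re_pos (by norm_num; positivity)
  rw [struveCoeff, struveCoeff, e, pow_succ]
  generalize Complex.Gamma ((k : ℂ) + 3 / 2) = G at hg ⊢
  generalize (k : ℂ) + 3 / 2 = q at h0 ⊢
  field_simp
  ring

theorem entireCoeff_struve : EntireCoeff struveCoeff := by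
  refine EntireCoeff.of_norm_le (C := ‖struveCoeff 0‖) (R := 1) fun k => ?_
  induction k with
  | zero => simp
  | succ k ih =>
    have h := congrArg norm (struveCoeff_recurrence k)
    have hn : ‖(k : ℂ) + 3 / 2‖ = k + 3 / 2 := by
      rw [show (k : ℂ) + 3 / 2 = ((k + 3 / 2 : ℝ) : ℂ) by push_cast; rfl, Complex.norm_real,
        Real.norm_of_nonneg (by positivity)]
    rw [norm_mul, norm_pow, norm_neg, hn] at h
    rw [← h] at ih
    rw [Nat.factorial_succ, one_pow]
    rw [one_pow] at ih
    push_cast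
    have hf : (0 : ℝ) < k.factorial := by exact_mod_cast k.factorial_pos
    rw [← div_div, mul_div_assoc', mul_div_assoc', mul_one] at *
    have hk : (0 : ℝ) ≤ k := k.cast_nonneg
    have h2 : ((k : ℝ) + 1) * ‖struveCoeff (k + 1)‖ ≤ (k + 3 / 2) ^ 2 * ‖struveCoeff (k + 1)‖ := by
      gcongr
      nlinarith
    rw [div_right_comm, le_div_iff₀ (by positivity), mul_comm]
    exact h2.trans ih

theorem struveCoeff_zero : struveCoeff 0 = 4 / Real.pi := by
  have h : Complex.Gamma (3 / 2) * Complex.Gamma (3 / 2) = Real.pi / 4 := by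
    have e : Complex.Gamma (3 / 2) = 1 / 2 * Complex.Gamma (1 / 2) := by
      rw [← Complex.Gamma_add_one _ (by norm_num)]
      norm_num
    have hp : ((Real.pi : ℂ) ^ (1 / 2 : ℂ)) * (Real.pi : ℂ) ^ (1 / 2 : ℂ) = Real.pi := by
      rw [← Complex.cpow_add _ _ (by exact_mod_cast Real.pi_ne_zero)]
      norm_num
    rw [e, Complex.Gamma_one_half_eq, mul_mul_mul_comm, hp]
    ring
  simp [struveCoeff, h]

theorem powerSum_sq_besselCoeff (w : ℂ) :
    powerSum (fun k => (k : ℂ) * (k * besselCoeff k)) w = -w * powerSum besselCoeff w := by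
  rw [powerSum_eq_add_mul entireCoeff_bessel.natCast_mul.natCast_mul, neg_mul, ← mul_neg,
    ← neg_one_mul, ← powerSum_const_mul _ (-1)]
  simp only [Nat.cast_zero, zero_mul, zero_add]
  refine congrArg (fun c => w * powerSum c w) (funext fun k => ?_)
  have hf : (k.factorial : ℂ) ≠ 0 := by exact_mod_cast k.factorial_ne_zero
  have hk : ((k : ℂ) + 1) ≠ 0 := by exact_mod_cast k.succ_ne_zero
  rw [besselCoeff, besselCoeff, Nat.factorial_succ, pow_succ]
  push_cast
  field_simp

/-- The first sum is the cross term produced when (z d/dz)² hits log(z/2) · J_0; on coefficients it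
is balanced by the inverse factorial in `recipGammaDeriv_recurrence`. -/
theorem powerSum_sq_weberCoeff (w : ℂ) :
    powerSum (fun k => (k : ℂ) * besselCoeff k) w +
      powerSum (fun k => (k : ℂ) * (k * weberCoeff k)) w = -w * powerSum weberCoeff w := by
  rw [← powerSum_add entireCoeff_bessel.natCast_mul entireCoeff_weber.natCast_mul.natCast_mul,
    powerSum_eq_add_mul (entireCoeff_bessel.natCast_mul.add
      entireCoeff_weber.natCast_mul.natCast_mul), neg_mul, ← mul_neg,
    ← neg_one_mul, ← powerSum_const_mul _ (-1)]
  simp only [Nat.cast_zero, zero_mul, zero_add]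
  refine congrArg (fun c => w * powerSum c w) (funext fun k => ?_)
  have hf : (k.factorial : ℂ) ≠ 0 := by exact_mod_cast k.factorial_ne_zero
  have hk : ((k : ℂ) + 1) ≠ 0 := by exact_mod_cast k.succ_ne_zero
  rw [besselCoeff, weberCoeff, weberCoeff, recipGammaDeriv_recurrence k, Nat.factorial_succ,
    pow_succ]
  push_cast
  field_simp
  ring

/-- The left side is (1 + 2θ)², the form (z d/dz)² takes after pulling out the factor z/2 of H_0.
The constant term 4/π survives and is the inhomogeneity of Struve's equation. -/
theorem powerSum_sq_struveCoeff (w : ℂ) :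
    powerSum struveCoeff w + 4 * powerSum (fun k => (k : ℂ) * struveCoeff k) w +
      4 * powerSum (fun k => (k : ℂ) * (k * struveCoeff k)) w =
        4 / Real.pi - 4 * w * powerSum struveCoeff w := by
  have h1 := entireCoeff_struve
  have h2 := h1.natCast_mul.const_mul 4
  have h3 := h1.natCast_mul.natCast_mul.const_mul 4
  rw [← powerSum_const_mul, ← powerSum_const_mul, ← powerSum_add h1 h2,
    ← powerSum_add (h1.add h2) h3, powerSum_eq_add_mul ((h1.add h2).add h3)]
  simp only [Nat.cast_zero, zero_mul, mul_zero, add_zero, struveCoeff_zero]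
  rw [sub_eq_add_neg, mul_comm 4 w, mul_assoc, ← mul_neg, ← neg_mul, ← powerSum_const_mul _ (-4)]
  refine congrArg (fun c => 4 / (Real.pi : ℂ) + w * powerSum c w) (funext fun k => ?_)
  have := struveCoeff_recurrence k
  push_cast
  linear_combination 4 * this

/-! ### Series representation of `Y_0 - H_0` -/

/-- Since |ν + k + 1| ≥ 1/2, each use of 1/Γ(s+1) = (1/Γ(s))/s costs a factor of at most 2. A bound
of this kind, uniform in ν, permits termwise differentiation of the Bessel series in ν. -/
theorem norm_recipGamma_le {ν : ℂ} {C : ℝ} (hν : ‖ν‖ < 1 / 2)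
    (hC : ‖(Complex.Gamma (ν + 1))⁻¹‖ ≤ C) (k : ℕ) :
    ‖(Complex.Gamma (ν + k + 1))⁻¹‖ ≤ C * 2 ^ k := by
  induction k with
  | zero => simpa using hC
  | succ k ih =>
    rw [Complex.one_div_Gamma_eq_self_mul_one_div_Gamma_add_one, norm_mul] at ih
    have hn : 1 / 2 ≤ ‖ν + k + 1‖ := by
      have h1 : ‖((k + 1 : ℕ) : ℂ)‖ ≤ ‖ν + k + 1‖ + ‖ν‖ := by
        rw [show ((k + 1 : ℕ) : ℂ) = (ν + k + 1) - ν by push_cast; ring]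
        exact norm_sub_le _ _
      rw [Complex.norm_natCast] at h1
      push_cast at h1
      linarith [(k.cast_nonneg : (0 : ℝ) ≤ k)]
    have e : ν + ((k + 1 : ℕ) : ℂ) + 1 = ν + k + 1 + 1 := by push_cast; ring
    rw [e, pow_succ]
    nlinarith [norm_nonneg (Complex.Gamma (ν + k + 1 + 1))⁻¹]

theorem hasDerivAt_besselSeries (w : ℂ) :
    HasDerivAt (fun ν : ℂ => ∑' k : ℕ,
      (-1) ^ k * w ^ k / ((k.factorial : ℂ) * Complex.Gamma (ν + k + 1)))
      (powerSum weberCoeff w) 0 := by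
  have hd := Complex.differentiable_one_div_Gamma
  obtain ⟨C, hC⟩ : ∃ C, ∀ ν ∈ Metric.closedBall (0 : ℂ) (1 / 2),
      ‖(Complex.Gamma (ν + 1))⁻¹‖ ≤ C :=
    (isCompact_closedBall _ _).exists_bound_of_continuousOn
      (hd.continuous.comp (continuous_id.add continuous_const)).continuousOn
  set F : ℕ → ℂ → ℂ := fun k ν =>
    (-1) ^ k * w ^ k / ((k.factorial : ℂ) * Complex.Gamma (ν + k + 1)) with hF
  have eF : ∀ k ν, F k ν =
      (-1) ^ k / (k.factorial : ℂ) * w ^ k * (Complex.Gamma (ν + (k + 1)))⁻¹ := by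
    intro k ν
    simp only [hF, ← add_assoc]
    rw [div_eq_mul_inv, mul_inv, div_eq_mul_inv]
    ring
  have hFd : ∀ k ν, HasDerivAt (F k) ((-1) ^ k / (k.factorial : ℂ) * w ^ k *
      deriv (fun s => (Complex.Gamma s)⁻¹) (ν + (k + 1))) ν := by
    intro k ν
    rw [funext (eF k)]
    exact ((hd _).hasDerivAt.comp_add_const ν ((k : ℂ) + 1)).const_mul _
  have hs : Summable fun k : ℕ => C * ((2 * ‖w‖) ^ k / k.factorial) :=
    (Real.summable_pow_div_factorial _).mul_left C
  have hb : ∀ k, ∀ ν ∈ Metric.ball (0 : ℂ) (1 / 2),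
      ‖F k ν‖ ≤ C * ((2 * ‖w‖) ^ k / k.factorial) := by
    intro k ν hν
    have h := norm_recipGamma_le (by simpa using hν) (hC ν (Metric.ball_subset_closedBall hν)) k
    rw [eF, ← add_assoc, norm_mul, norm_mul, norm_div, norm_pow, norm_pow, norm_neg, norm_one,
      one_pow, Complex.norm_natCast]
    refine (mul_le_mul_of_nonneg_left h (by positivity)).trans_eq ?_
    rw [mul_pow]
    ring
  have hdF : ∀ k, DifferentiableOn ℂ (F k) (Metric.ball 0 (1 / 2)) := fun k ν _ =>
    (hFd k ν).differentiableAt.differentiableWithinAt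
  have h0 : (0 : ℂ) ∈ Metric.ball (0 : ℂ) (1 / 2) := by simp
  have h := Complex.hasSum_deriv_of_summable_norm hs hdF Metric.isOpen_ball hb h0
  have e : powerSum weberCoeff w = deriv (fun ν => ∑' k, F k ν) 0 := by
    rw [← h.tsum_eq, powerSum]
    congr 1 with k
    rw [(hFd k 0).deriv, weberCoeff, recipGammaDeriv, zero_add]
    ring
  rw [e]
  exact ((Complex.differentiableOn_tsum_of_summable_norm hs hdF Metric.isOpen_ball
    hb).differentiableAt (Metric.isOpen_ball.mem_nhds h0)).hasDerivAt

theorem besselY_zero_eq {z : ℂ} (hz : z ≠ 0) :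
    besselY 0 z = 2 / Real.pi * (Complex.log (z / 2) * powerSum besselCoeff (z ^ 2 / 4) +
      powerSum weberCoeff (z ^ 2 / 4)) := by
  have h1 : HasDerivAt (fun ν : ℂ => (z / 2) ^ ν) ((z / 2) ^ (0 : ℂ) * Complex.log (z / 2) * 1) 0 :=
    (hasDerivAt_id (0 : ℂ)).const_cpow (Or.inl (div_ne_zero hz two_ne_zero))
  have h := (h1.mul (hasDerivAt_besselSeries (z ^ 2 / 4))).deriv
  have e : (fun ν : ℂ => besselJ ν z) = (fun ν : ℂ => (z / 2) ^ ν) * fun ν : ℂ => ∑' k : ℕ,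
      (-1) ^ k * (z ^ 2 / 4) ^ k / ((k.factorial : ℂ) * Complex.Gamma (ν + k + 1)) := rfl
  have hJ : ∑' k : ℕ, (-1) ^ k * (z ^ 2 / 4) ^ k /
      ((k.factorial : ℂ) * Complex.Gamma (0 + k + 1)) = powerSum besselCoeff (z ^ 2 / 4) := by
    rw [powerSum]
    congr 1 with k
    rw [zero_add, Complex.Gamma_nat_eq_factorial, besselCoeff]
    ring
  -- At order 0 the two derivatives in `besselY` coincide, whence the factor 2/π.
  rw [besselY, Nat.cast_zero, neg_zero, e, h, hJ, Complex.cpow_zero]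
  ring

theorem struveH_zero_eq (z : ℂ) :
    struveH 0 z = z / 2 * powerSum struveCoeff (z ^ 2 / 4) := by
  rw [struveH, zero_add, Complex.cpow_one, powerSum]
  congr 2 with k
  rw [add_zero, struveCoeff, pow_mul, div_pow]
  norm_num
  ring

/-! ### The Laplace transform of `1 / √(1 + ξ²)` -/

theorem integrableOn_pow_mul_exp_neg_mul (m : ℕ) {b : ℝ} (hb : 0 < b) :
    IntegrableOn (fun ξ : ℝ => ξ ^ m * Real.exp (-b * ξ)) (Ioi 0) := by
  have hm : (-1 : ℝ) < m := by linarith [(m.cast_nonneg : (0 : ℝ) ≤ m)]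
  have h := integrableOn_rpow_mul_exp_neg_mul_rpow hm one_pos hb
  simpa only [Real.rpow_one, Real.rpow_natCast] using h

theorem norm_cexp_neg_mul_ofReal (z : ℂ) (ξ : ℝ) :
    ‖Complex.exp (-z * ξ)‖ = Real.exp (-z.re * ξ) := by
  simp [Complex.norm_exp]

theorem integrableOn_mul_cexp {f : ℝ → ℂ} (hf : Continuous f) {m : ℕ}
    (hfm : ∀ ξ, 0 < ξ → ‖f ξ‖ ≤ 1 + ξ ^ m) {z : ℂ} (hz : 0 < z.re) :
    IntegrableOn (fun ξ : ℝ => f ξ * Complex.exp (-z * ξ)) (Ioi 0) := by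
  have h := (integrableOn_pow_mul_exp_neg_mul 0 hz).add (integrableOn_pow_mul_exp_neg_mul m hz)
  refine h.mono' (by fun_prop) ?_
  filter_upwards [ae_restrict_mem measurableSet_Ioi] with ξ hξ
  rw [norm_mul, norm_cexp_neg_mul_ofReal, Pi.add_apply, ← add_mul, pow_zero]
  gcongr
  exact hfm ξ hξ

theorem one_le_sqrt_one_add_sq (ξ : ℝ) : 1 ≤ √(1 + ξ ^ 2) :=
  Real.one_le_sqrt.2 (by nlinarith [sq_nonneg ξ])

theorem continuous_inv_sqrt : Continuous fun ξ : ℝ => (√(1 + ξ ^ 2))⁻¹ :=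
  Continuous.inv₀ (by fun_prop) fun ξ => (zero_lt_one.trans_le (one_le_sqrt_one_add_sq ξ)).ne'

/-- The weight `(-ξ)^l / √(1 + ξ²)`, whose Laplace transform is the `l`-th derivative of that of
`1 / √(1 + ξ²)`. -/
noncomputable def momentWeight (l : ℕ) (ξ : ℝ) : ℂ := (-(ξ : ℂ)) ^ l * ((√(1 + ξ ^ 2))⁻¹ : ℝ)

/-- The `l`-th derivative of the Laplace transform of `1 / √(1 + ξ²)`. -/
noncomputable def laplaceMoment (l : ℕ) (z : ℂ) : ℂ :=
  ∫ ξ in Ioi (0 : ℝ), momentWeight l ξ * Complex.exp (-z * ξ)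

theorem continuous_momentWeight (l : ℕ) : Continuous (momentWeight l) :=
  Continuous.mul (by fun_prop) (Complex.continuous_ofReal.comp continuous_inv_sqrt)

theorem norm_momentWeight_le (l : ℕ) {ξ : ℝ} (hξ : 0 < ξ) : ‖momentWeight l ξ‖ ≤ ξ ^ l := by
  have h := one_le_sqrt_one_add_sq ξ
  rw [momentWeight, norm_mul, norm_pow, norm_neg, Complex.norm_real, Complex.norm_real,
    Real.norm_of_nonneg hξ.le, Real.norm_of_nonneg (by positivity)]
  exact mul_le_of_le_one_right (by positivity) (inv_le_one_of_one_le₀ h)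

theorem integrableOn_momentWeight (l : ℕ) {z : ℂ} (hz : 0 < z.re) :
    IntegrableOn (fun ξ : ℝ => momentWeight l ξ * Complex.exp (-z * ξ)) (Ioi 0) :=
  integrableOn_mul_cexp (continuous_momentWeight l) (m := l)
    (fun ξ hξ => (norm_momentWeight_le l hξ).trans (by linarith)) hz

theorem hasDerivAt_laplaceMoment (l : ℕ) {z : ℂ} (hz : 0 < z.re) :
    HasDerivAt (laplaceMoment l) (laplaceMoment (l + 1) z) z := by
  -- On this neighbourhood one exponential e^{-(Re z/2)ξ} dominates every integrand.
  have hs : {v : ℂ | z.re / 2 < v.re} ∈ 𝓝 z :=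
    (isOpen_lt continuous_const Complex.continuous_re).mem_nhds (by simpa using half_lt_self hz)
  have hc := continuous_momentWeight
  refine (hasDerivAt_integral_of_dominated_loc_of_deriv_le
    (F := fun v (ξ : ℝ) => momentWeight l ξ * Complex.exp (-v * ξ))
    (F' := fun v (ξ : ℝ) => momentWeight (l + 1) ξ * Complex.exp (-v * ξ))
    (bound := fun ξ => ξ ^ (l + 1) * Real.exp (-(z.re / 2) * ξ)) hs
    (Eventually.of_forall fun v => ?_) (integrableOn_momentWeight l hz) ?_ ?_
    (integrableOn_pow_mul_exp_neg_mul (l + 1) (by positivity)) ?_).2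
  · exact ((hc l).mul (by fun_prop)).aestronglyMeasurable
  · exact ((hc (l + 1)).mul (by fun_prop)).aestronglyMeasurable
  · filter_upwards [ae_restrict_mem measurableSet_Ioi] with ξ hξ v hv
    have hξ' : 0 < ξ := hξ
    have hv' : z.re / 2 < v.re := hv
    rw [norm_mul, norm_cexp_neg_mul_ofReal]
    gcongr
    exact norm_momentWeight_le _ hξ
  · refine Eventually.of_forall fun ξ v _ => ?_
    have h := ((hasDerivAt_neg v).mul_const (ξ : ℂ)).cexp.const_mul (momentWeight l ξ)
    refine h.congr_deriv ?_
    simp only [momentWeight, pow_succ]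
    ring

theorem iteratedDeriv_laplaceMoment (l : ℕ) {z : ℂ} (hz : 0 < z.re) :
    iteratedDeriv l (laplaceMoment 0) z = laplaceMoment l z := by
  induction l generalizing z with
  | zero => simp
  | succ l ih =>
    rw [iteratedDeriv_succ, ← (hasDerivAt_laplaceMoment l hz).deriv]
    refine EventuallyEq.deriv_eq ?_
    filter_upwards [(isOpen_lt continuous_const Complex.continuous_re).mem_nhds hz] with v hv
    exact ih hv

theorem norm_laplaceMoment_le (l : ℕ) {z : ℂ} (hz : 0 < z.re) :
    ‖laplaceMoment l z‖ ≤ l.factorial * (1 / z.re) ^ (l + 1) := by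
  have e : ∫ ξ in Ioi (0 : ℝ), ξ ^ l * Real.exp (-z.re * ξ) =
      l.factorial * (1 / z.re) ^ (l + 1) := by
    have h := Real.integral_rpow_mul_exp_neg_mul_Ioi (a := (l : ℝ) + 1) (r := z.re)
      (by positivity) hz
    rw [Real.Gamma_nat_eq_factorial, mul_comm] at h
    rw [← Nat.cast_add_one, Real.rpow_natCast] at h
    rw [← h]
    refine setIntegral_congr_fun measurableSet_Ioi fun ξ _ => ?_
    simp
  rw [← e]
  refine norm_integral_le_of_norm_le (integrableOn_pow_mul_exp_neg_mul l hz) ?_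
  filter_upwards [ae_restrict_mem measurableSet_Ioi] with ξ hξ
  rw [norm_mul, norm_cexp_neg_mul_ofReal]
  gcongr
  exact norm_momentWeight_le l hξ

theorem tendsto_mul_cexp_atTop {f : ℝ → ℂ} {m : ℕ}
    (hfm : ∀ ξ, 0 < ξ → ‖f ξ‖ ≤ 1 + ξ ^ m) {z : ℂ} (hz : 0 < z.re) :
    Tendsto (fun ξ : ℝ => f ξ * Complex.exp (-z * ξ)) atTop (𝓝 0) := by
  have h (k : ℕ) : Tendsto (fun ξ : ℝ => ξ ^ k * Real.exp (-z.re * ξ)) atTop (𝓝 0) := by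
    simpa only [Real.rpow_natCast] using tendsto_rpow_mul_exp_neg_mul_atTop_nhds_zero k z.re hz
  have h2 := (h 0).add (h m)
  rw [add_zero] at h2
  refine squeeze_zero_norm' ?_ h2
  filter_upwards [eventually_gt_atTop 0] with ξ hξ
  rw [norm_mul, norm_cexp_neg_mul_ofReal, ← add_mul, pow_zero]
  gcongr
  exact hfm ξ hξ

/-- The inhomogeneous Bessel equation satisfied by the Laplace transform of `1 / √(1 + ξ²)`. -/
theorem laplaceMoment_bessel_equation {z : ℂ} (hz : 0 < z.re) :
    laplaceMoment 1 z + z * laplaceMoment 2 z = 1 - z * laplaceMoment 0 z := by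
  have hb : ∀ ξ : ℝ, 0 < ξ → ‖((√(1 + ξ ^ 2) : ℝ) : ℂ)‖ ≤ 1 + ξ ^ 1 := fun ξ hξ => by
    rw [Complex.norm_real, Real.norm_of_nonneg (Real.sqrt_nonneg _), pow_one]
    exact Real.sqrt_le_iff.2 ⟨by positivity, by nlinarith⟩
  -- Integrate the derivative of √(1+ξ²) e^{-zξ}, using √(1+ξ²) = (1+ξ²)/√(1+ξ²); the boundary value
  -- 1 at ξ = 0 is the inhomogeneity.
  have key := integral_Ioi_of_hasDerivAt_of_tendsto (a := 0) (m := 0)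
    (f := fun ξ : ℝ => ((√(1 + ξ ^ 2) : ℝ) : ℂ) * Complex.exp (-z * ξ))
    (f' := fun ξ : ℝ => -(momentWeight 1 ξ * Complex.exp (-z * ξ)) -
      z * (momentWeight 0 ξ * Complex.exp (-z * ξ) + momentWeight 2 ξ * Complex.exp (-z * ξ)))
    (by fun_prop) ?_ ?_ (tendsto_mul_cexp_atTop hb hz)
  · have i (l : ℕ) := integrableOn_momentWeight l hz
    have e := integral_sub (i 1).neg (((i 0).add (i 2)).const_mul z)
    simp only [Pi.neg_apply, Pi.add_apply] at e
    rw [e, integral_neg, integral_const_mul, integral_add (i 0) (i 2)] at key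
    change -laplaceMoment 1 z - z * (laplaceMoment 0 z + laplaceMoment 2 z) = _ at key
    simp at key
    linear_combination -key
  · intro ξ _
    have hp := zero_lt_one.trans_le (one_le_sqrt_one_add_sq ξ)
    have h1 : HasDerivAt (fun ξ : ℝ => √(1 + ξ ^ 2)) (ξ * (√(1 + ξ ^ 2))⁻¹) ξ := by
      have := (((hasDerivAt_id ξ).pow 2).const_add 1).sqrt
        (show 1 + ξ ^ 2 ≠ 0 by positivity)
      refine this.congr_deriv ?_
      simp
      field_simp
    have h2 := h1.ofReal_comp.mul (((Complex.ofRealCLM.hasDerivAt (x := ξ)).const_mul (-z)).cexp)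
    refine h2.congr_deriv ?_
    have hq : ((√(1 + ξ ^ 2) : ℝ) : ℂ) * ((√(1 + ξ ^ 2) : ℝ) : ℂ) = 1 + (ξ : ℂ) ^ 2 := by
      exact_mod_cast Real.mul_self_sqrt (by positivity)
    have hs : ((√(1 + ξ ^ 2) : ℝ) : ℂ) ≠ 0 := by exact_mod_cast hp.ne'
    simp only [momentWeight, Complex.ofRealCLM_apply]
    push_cast
    field_simp
    linear_combination (-z) * hq
  · have i (l : ℕ) := integrableOn_momentWeight l hz
    exact (i 1).neg.sub (((i 0).add (i 2)).const_mul z)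

/-- As x∫e^{-xξ} dξ = 1, the error is x∫(1 - ξ/√(1+ξ²)) e^{-xξ} dξ, whose integrand is at most
1/(1+ξ²); so it is O(x). -/
theorem tendsto_mul_laplaceMoment_one :
    Tendsto (fun x : ℝ => (x : ℂ) * laplaceMoment 1 x) (𝓝[>] 0) (𝓝 (-1)) := by
  set K : ℝ := ∫ ξ in Ioi (0 : ℝ), (1 + ξ ^ 2)⁻¹
  have hle : ∀ x : ℝ, 0 < x → ‖(x : ℂ) * laplaceMoment 1 x - (-1)‖ ≤ x * K := by
    intro x hx
    have hx' : 0 < (x : ℂ).re := by simpa using hx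
    have i1 := integrableOn_momentWeight 1 hx'
    have i0 := integrableOn_mul_cexp (f := fun _ => 1) continuous_const (m := 0)
      (fun ξ _ => by simp) hx'
    have e0 : ∫ ξ in Ioi (0 : ℝ), (1 : ℂ) * Complex.exp (-x * ξ) = 1 / x := by
      have := integral_exp_mul_complex_Ioi (a := -(x : ℂ)) (by simpa using hx) 0
      simp only [one_mul]
      rw [this]
      simp
    have e : (x : ℂ) * laplaceMoment 1 x - (-1) = x * ∫ ξ in Ioi (0 : ℝ),
        (momentWeight 1 ξ * Complex.exp (-x * ξ) + 1 * Complex.exp (-x * ξ)) := by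
      rw [integral_add i1 i0, e0, mul_add, mul_one_div_cancel (by exact_mod_cast hx.ne'),
        sub_neg_eq_add]
      rfl
    rw [e, norm_mul, Complex.norm_real, Real.norm_of_nonneg hx.le]
    refine mul_le_mul_of_nonneg_left ?_ hx.le
    refine norm_integral_le_of_norm_le integrable_inv_one_add_sq.integrableOn ?_
    filter_upwards [ae_restrict_mem measurableSet_Ioi] with ξ hξ
    have hξ' : 0 < ξ := hξ
    have hp := zero_lt_one.trans_le (one_le_sqrt_one_add_sq ξ)
    rw [← add_mul, norm_mul, norm_cexp_neg_mul_ofReal]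
    have hE : Real.exp (-(x : ℂ).re * ξ) ≤ 1 := by
      rw [Real.exp_le_one_iff, Complex.ofReal_re]
      nlinarith
    have hq : √(1 + ξ ^ 2) * √(1 + ξ ^ 2) = 1 + ξ ^ 2 := Real.mul_self_sqrt (by positivity)
    have hlt : ξ ≤ √(1 + ξ ^ 2) := Real.le_sqrt_of_sq_le (by linarith)
    have e2 : momentWeight 1 ξ + 1 = ((1 - ξ * (√(1 + ξ ^ 2))⁻¹ : ℝ) : ℂ) := by
      simp only [momentWeight, pow_one]
      push_cast
      ring
    have h3 : 0 ≤ 1 - ξ * (√(1 + ξ ^ 2))⁻¹ := by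
      rw [sub_nonneg, ← div_eq_mul_inv, div_le_one hp]
      exact hlt
    rw [e2, Complex.norm_real, Real.norm_of_nonneg h3]
    refine (mul_le_of_le_one_right h3 hE).trans ?_
    have h5 : (1 + ξ ^ 2)⁻¹ = (√(1 + ξ ^ 2))⁻¹ * (√(1 + ξ ^ 2))⁻¹ := by rw [← mul_inv, hq]
    have h4 : 1 - ξ * (√(1 + ξ ^ 2))⁻¹ = (√(1 + ξ ^ 2) - ξ) * (√(1 + ξ ^ 2))⁻¹ := by
      field_simp
    rw [h4, h5]
    refine mul_le_mul_of_nonneg_right ?_ (by positivity)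
    rw [← one_div, le_div_iff₀ hp]
    nlinarith
  rw [tendsto_iff_norm_sub_tendsto_zero]
  have h0 : Tendsto (fun x : ℝ => x * K) (𝓝[>] 0) (𝓝 0) := by
    have : Tendsto (fun x : ℝ => x * K) (𝓝 0) (𝓝 (0 * K)) :=
      (continuous_id.mul continuous_const).tendsto 0
    rw [zero_mul] at this
    exact this.mono_left nhdsWithin_le_nhds
  refine squeeze_zero' (Eventually.of_forall fun _ => norm_nonneg _) ?_ h0
  filter_upwards [self_mem_nhdsWithin] with x hx using hle x hx

/-! ### Behaviour at the origin -/

/-- This is -Γ'(1), left as an integral so that it can be matched with the limit of F without naming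
Euler's constant. -/
theorem recipGammaDeriv_zero :
    recipGammaDeriv 0 = -((∫ u in Ioi (0 : ℝ), Real.log u * Real.exp (-u) : ℝ) : ℂ) := by
  have h := Complex.hasDerivAt_GammaIntegral (s := 1) (by simp)
  have hG : HasDerivAt Complex.Gamma
      (∫ t in Ioi (0 : ℝ), (t : ℂ) ^ ((1 : ℂ) - 1) * (Real.log t * Real.exp (-t))) 1 := by
    refine h.congr_of_eventuallyEq ?_
    filter_upwards [(isOpen_lt continuous_const Complex.continuous_re).mem_nhds
      (show (0 : ℝ) < (1 : ℂ).re by simp)] with v hv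
    exact Complex.Gamma_eq_integral hv
  have h2 := (hG.inv (by simp)).deriv
  rw [recipGammaDeriv, Nat.cast_zero, zero_add]
  change deriv (Complex.Gamma)⁻¹ 1 = _
  rw [h2, ← integral_complex_ofReal]
  simp

theorem arsinh_le_self {ξ : ℝ} (hξ : 0 ≤ ξ) : Real.arsinh ξ ≤ ξ := by
  rw [← Real.arsinh_sinh ξ, Real.arsinh_le_arsinh, Real.arsinh_sinh]
  exact Real.self_le_sinh_iff.2 hξ

/-- Integrate by parts with arsinh' = 1/√(1+ξ²), then substitute u = xξ. -/
theorem laplaceMoment_zero_eq_arsinh {x : ℝ} (hx : 0 < x) :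
    laplaceMoment 0 x = ((∫ u in Ioi (0 : ℝ), Real.arsinh (u / x) * Real.exp (-u) : ℝ) : ℂ) := by
  have hx' : 0 < (x : ℂ).re := by simpa using hx
  have hb : ∀ ξ : ℝ, 0 < ξ → ‖((Real.arsinh ξ : ℝ) : ℂ)‖ ≤ 1 + ξ ^ 1 := fun ξ hξ => by
    rw [Complex.norm_real, Real.norm_of_nonneg (Real.arsinh_nonneg_iff.2 hξ.le), pow_one]
    linarith [arsinh_le_self hξ.le]
  have hca : Continuous fun ξ : ℝ => ((Real.arsinh ξ : ℝ) : ℂ) :=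
    Complex.continuous_ofReal.comp Real.continuous_arsinh
  have i0 := integrableOn_momentWeight 0 hx'
  have ia := integrableOn_mul_cexp hca hb hx'
  have key := integral_Ioi_of_hasDerivAt_of_tendsto (a := 0) (m := 0)
    (f := fun ξ : ℝ => ((Real.arsinh ξ : ℝ) : ℂ) * Complex.exp (-x * ξ))
    (f' := fun ξ : ℝ => momentWeight 0 ξ * Complex.exp (-x * ξ) -
      x * (((Real.arsinh ξ : ℝ) : ℂ) * Complex.exp (-x * ξ)))
    (hca.mul (by fun_prop)).continuousWithinAt (fun ξ _ => ?_) (i0.sub (ia.const_mul _))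
    (tendsto_mul_cexp_atTop hb hx')
  · rw [integral_sub i0 (ia.const_mul _), integral_const_mul] at key
    simp only [Real.arsinh_zero, Complex.ofReal_zero, zero_mul, sub_zero] at key
    rw [sub_eq_zero] at key
    change laplaceMoment 0 x = _ at key
    rw [key]
    have hs := integral_comp_mul_left_Ioi
      (fun u => Real.arsinh (u / x) * Real.exp (-u)) 0 hx
    rw [mul_zero, smul_eq_mul, eq_inv_mul_iff_mul_eq₀ hx.ne'] at hs
    rw [← hs]
    push_cast
    rw [← integral_complex_ofReal]
    congr 1
    refine integral_congr_ae (Eventually.of_forall fun ξ => ?_)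
    simp only [mul_div_cancel_left₀ ξ hx.ne']
    push_cast
    simp
  · have h2 := (Real.hasDerivAt_arsinh ξ).ofReal_comp.mul
      (((Complex.ofRealCLM.hasDerivAt (x := ξ)).const_mul (-(x : ℂ))).cexp)
    refine h2.congr_deriv ?_
    simp only [momentWeight, Complex.ofRealCLM_apply]
    push_cast
    ring

/-- Apply log y ≤ y - 1 to y = u and to y = u^{-1/2}. The majorant is integrable against e^{-u}. -/
theorem abs_log_le_rpow_add {u : ℝ} (hu : 0 < u) : |Real.log u| ≤ 2 * u ^ (-(1 / 2) : ℝ) + u := by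
  have h1 := Real.log_le_sub_one_of_pos hu
  have h2 := Real.log_le_sub_one_of_pos (Real.rpow_pos_of_pos hu (-(1 / 2)))
  rw [Real.log_rpow hu] at h2
  have h3 := Real.rpow_pos_of_pos hu (-(1 / 2))
  rw [abs_le]
  constructor <;> linarith

/-- Since e^{-u} has mass 1, log(x/2) moves under the integral, where arsinh(u/x) + log(x/2) =
log((u + √(x²+u²))/2) tends to log u, with domination for x ≤ 1. -/
theorem tendsto_laplaceMoment_zero_add_log :
    Tendsto (fun x : ℝ => laplaceMoment 0 x + (Real.log (x / 2) : ℝ)) (𝓝[>] 0)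
      (𝓝 (-recipGammaDeriv 0)) := by
  have ig : IntegrableOn (fun u : ℝ => (2 * u ^ (-(1 / 2) : ℝ) + u) * Real.exp (-u)) (Ioi 0) := by
    have h1 := integrableOn_rpow_mul_exp_neg_mul_rpow (p := 1) (s := -(1 / 2)) (b := 1)
      (by norm_num) one_pos one_pos
    have h2 := integrableOn_pow_mul_exp_neg_mul 1 one_pos
    refine IntegrableOn.congr_fun ((h1.const_mul 2).add h2) (fun u _ => ?_) measurableSet_Ioi
    simp
    ring
  have iE : IntegrableOn (fun u : ℝ => Real.exp (-u)) (Ioi 0) := by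
    simpa using integrableOn_pow_mul_exp_neg_mul 0 one_pos
  have hE : ∫ u in Ioi (0 : ℝ), Real.exp (-u) = 1 := integral_exp_neg_Ioi_zero
  have hlog : ∀ x : ℝ, 0 < x → ∀ u : ℝ, 0 < u → Real.arsinh (u / x) + Real.log (x / 2) =
      Real.log ((u + √(x ^ 2 + u ^ 2)) / 2) := by
    intro x hx u hu
    have e : √(1 + (u / x) ^ 2) = √(x ^ 2 + u ^ 2) / x := by
      rw [show 1 + (u / x) ^ 2 = (x ^ 2 + u ^ 2) / x ^ 2 by field_simp,
        Real.sqrt_div (by positivity), Real.sqrt_sq hx.le]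
    have hp : 0 < u + √(x ^ 2 + u ^ 2) := by positivity
    rw [Real.arsinh, e, ← Real.log_mul (by positivity) (by positivity)]
    congr 1
    field_simp
  have hbound : ∀ x : ℝ, 0 < x → x ≤ 1 → ∀ u : ℝ, 0 < u →
      |Real.log ((u + √(x ^ 2 + u ^ 2)) / 2)| ≤ 2 * u ^ (-(1 / 2) : ℝ) + u := by
    intro x hx hx1 u hu
    have h1 : u ≤ √(x ^ 2 + u ^ 2) := Real.le_sqrt_of_sq_le (by nlinarith)
    have h2 : √(x ^ 2 + u ^ 2) ≤ x + u := Real.sqrt_le_iff.2 ⟨by positivity, by nlinarith⟩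
    have h3 := abs_le.1 (abs_log_le_rpow_add hu)
    have h4 := Real.log_le_log hu (show u ≤ (u + √(x ^ 2 + u ^ 2)) / 2 by linarith)
    have h5 := Real.log_le_sub_one_of_pos
      (show 0 < (u + √(x ^ 2 + u ^ 2)) / 2 by positivity)
    have h6 := Real.rpow_pos_of_pos hu (-(1 / 2))
    rw [abs_le]
    constructor <;> linarith
  have hlim : Tendsto (fun x : ℝ => ∫ u in Ioi (0 : ℝ),
      Real.log ((u + √(x ^ 2 + u ^ 2)) / 2) * Real.exp (-u)) (𝓝[>] 0)
      (𝓝 (∫ u in Ioi (0 : ℝ), Real.log u * Real.exp (-u))) := by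
    refine tendsto_integral_filter_of_dominated_convergence _
      (Eventually.of_forall fun x => ?_) ?_ ig ?_
    · exact (by fun_prop : Measurable _).aestronglyMeasurable
    · filter_upwards [Ioc_mem_nhdsGT (zero_lt_one' ℝ)] with x hx
      filter_upwards [ae_restrict_mem measurableSet_Ioi] with u hu
      rw [norm_mul, Real.norm_eq_abs, Real.norm_of_nonneg (Real.exp_pos _).le]
      exact mul_le_mul_of_nonneg_right (hbound x hx.1 hx.2 u hu) (Real.exp_pos _).le
    · filter_upwards [ae_restrict_mem measurableSet_Ioi] with u hu
      have hu' : 0 < u := hu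
      have hc : ContinuousAt (fun x : ℝ => Real.log ((u + √(x ^ 2 + u ^ 2)) / 2) *
          Real.exp (-u)) 0 := by
        refine ContinuousAt.mul (ContinuousAt.log (by fun_prop) ?_) continuousAt_const
        positivity
      have := hc.tendsto
      simp only [ne_eq, OfNat.ofNat_ne_zero, not_false_eq_true, zero_pow, zero_add,
        Real.sqrt_sq hu'.le, add_self_div_two] at this
      exact this.mono_left nhdsWithin_le_nhds
  rw [recipGammaDeriv_zero, neg_neg]
  refine ((Complex.continuous_ofReal.tendsto _).comp hlim).congr' ?_
  filter_upwards [Ioc_mem_nhdsGT (zero_lt_one' ℝ)] with x hx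
  rw [Function.comp_apply, laplaceMoment_zero_eq_arsinh hx.1, ← Complex.ofReal_add]
  congr 1
  have ia : IntegrableOn (fun u : ℝ => Real.arsinh (u / x) * Real.exp (-u)) (Ioi 0) := by
    have hm : AEStronglyMeasurable (fun u : ℝ => Real.arsinh (u / x) * Real.exp (-u))
        (volume.restrict (Ioi 0)) :=
      ((Real.continuous_arsinh.comp (continuous_id.div_const x)).mul
        (by fun_prop)).aestronglyMeasurable
    have h1 := (integrableOn_pow_mul_exp_neg_mul 1 one_pos).const_mul x⁻¹
    refine h1.mono' hm ?_
    filter_upwards [ae_restrict_mem measurableSet_Ioi] with u hu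
    have hux : 0 ≤ u / x := div_nonneg (le_of_lt hu) hx.1.le
    rw [norm_mul, Real.norm_of_nonneg (Real.arsinh_nonneg_iff.2 hux),
      Real.norm_of_nonneg (Real.exp_pos _).le, pow_one, neg_one_mul, ← mul_assoc]
    refine mul_le_mul_of_nonneg_right ((arsinh_le_self hux).trans_eq ?_) (Real.exp_pos _).le
    rw [div_eq_inv_mul]
  rw [← mul_one (Real.log (x / 2)), ← hE, ← integral_const_mul,
    ← integral_add ia (iE.const_mul _)]
  refine setIntegral_congr_fun measurableSet_Ioi fun u hu => ?_
  rw [← add_mul, hlog x hx.1 u hu]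

/-! ### Identification of the Laplace transform with `-(π / 2) (Y_0 - H_0)` -/

/-- A solution of the homogeneous Bessel equation, with its Euler derivative, vanishes near the
origin if both tend to zero there. -/
theorem eq_zero_of_bessel_equation {D E : ℝ → ℂ}
    (hD : ∀ x, 0 < x → HasDerivAt D (E x / x) x)
    (hE : ∀ x, 0 < x → HasDerivAt E (-x * D x) x)
    (hD0 : Tendsto D (𝓝[>] 0) (𝓝 0)) (hE0 : Tendsto E (𝓝[>] 0) (𝓝 0)) :
    ∃ δ > 0, ∀ x ∈ Ioo 0 δ, D x = 0 := by
  -- Mean value inequality on [y, x] with y → 0+, where f(y) → 0.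
  have mvt : ∀ {f f' : ℝ → ℂ} {C x : ℝ}, (∀ y, 0 < y → HasDerivAt f (f' y) y) →
      Tendsto f (𝓝[>] 0) (𝓝 0) → 0 < x → 0 ≤ C → (∀ y ∈ Ioc 0 x, ‖f' y‖ ≤ C) →
      ‖f x‖ ≤ C * x := by
    intro f f' C x hf hf0 hx hC hb
    have h : Tendsto (fun y => ‖f x - f y‖) (𝓝[>] 0) (𝓝 ‖f x - 0‖) :=
      (tendsto_const_nhds.sub hf0).norm
    rw [sub_zero] at h
    refine le_of_tendsto h ?_
    filter_upwards [Ioc_mem_nhdsGT hx] with y hy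
    have := (convex_Ioc (0 : ℝ) x).norm_image_sub_le_of_norm_hasDerivWithin_le
      (fun v hv => (hf v hv.1).hasDerivWithinAt) hb hy ⟨hx, le_rfl⟩
    refine this.trans (mul_le_mul_of_nonneg_left ?_ hC)
    rw [Real.norm_of_nonneg (by linarith [hy.2])]
    linarith [hy.1]
  obtain ⟨δ, hδ, hδD⟩ : ∃ δ > 0, ∀ x ∈ Ioo 0 δ, ‖D x‖ ≤ 1 := by
    have h := hD0.norm.eventually_le_const (u := 1) (by simp)
    obtain ⟨δ, hδ, h⟩ := (mem_nhdsGT_iff_exists_Ioo_subset).1 h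
    exact ⟨δ, hδ, h⟩
  refine ⟨min δ (1 / 2), by positivity, ?_⟩
  -- A bound C on D gives |E'| ≤ C, so |E(y)| ≤ Cy, so |D'| ≤ C, so |D(x)| ≤ Cx ≤ C/2: each pass
  -- halves the bound.
  have hn : ∀ n : ℕ, ∀ x ∈ Ioo 0 (min δ (1 / 2)), ‖D x‖ ≤ (1 / 2) ^ n := by
    intro n
    induction n with
    | zero => exact fun x hx => by simpa using hδD x ⟨hx.1, hx.2.trans_le (min_le_left _ _)⟩
    | succ n ih =>
      intro x hx
      have hx2 : x < 1 / 2 := hx.2.trans_le (min_le_right _ _)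
      have hEb : ∀ y ∈ Ioc 0 x, ‖E y‖ ≤ (1 / 2) ^ n * y := by
        intro y hy
        refine mvt hE hE0 hy.1 (by positivity) fun v hv => ?_
        have hDv := ih v ⟨hv.1, (hv.2.trans hy.2).trans_lt hx.2⟩
        have hv1 : v ≤ 1 := by linarith [hv.2, hy.2]
        rw [norm_mul, norm_neg, Complex.norm_real, Real.norm_of_nonneg hv.1.le]
        exact (mul_le_of_le_one_left (norm_nonneg _) hv1).trans hDv
      have h := mvt hD hD0 hx.1 (C := (1 / 2) ^ n) (by positivity) fun y hy => by
        rw [norm_div, Complex.norm_real, Real.norm_of_nonneg hy.1.le, div_le_iff₀ hy.1]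
        exact hEb y hy
      refine h.trans ?_
      rw [pow_succ]
      gcongr
  intro x hx
  have h := ge_of_tendsto'
    (tendsto_pow_atTop_nhds_zero_of_lt_one (by norm_num : (0 : ℝ) ≤ 1 / 2) (by norm_num))
    fun n => hn n x hx
  exact norm_le_zero_iff.1 h

/-- The sum of the Laplace transform of `1 / √(1 + ξ²)` and `(π / 2) (Y_0 - H_0)`. -/
noncomputable def besselDefect (z : ℂ) : ℂ :=
  laplaceMoment 0 z + (Complex.log (z / 2) * powerSum besselCoeff (z ^ 2 / 4) +
    powerSum weberCoeff (z ^ 2 / 4)) -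
    Real.pi / 2 * (z / 2 * powerSum struveCoeff (z ^ 2 / 4))

/-- The Euler derivative `z ↦ z f'(z)` of `f = besselDefect`. -/
noncomputable def besselDefectEuler (z : ℂ) : ℂ :=
  z * laplaceMoment 1 z + (powerSum besselCoeff (z ^ 2 / 4) +
    2 * (Complex.log (z / 2) * powerSum (fun k => (k : ℂ) * besselCoeff k) (z ^ 2 / 4)) +
    2 * powerSum (fun k => (k : ℂ) * weberCoeff k) (z ^ 2 / 4)) -
    Real.pi / 2 * (z / 2 * (powerSum struveCoeff (z ^ 2 / 4) +
      2 * powerSum (fun k => (k : ℂ) * struveCoeff k) (z ^ 2 / 4)))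

theorem hasDerivAt_log_half {z : ℂ} (hz : 0 < z.re) :
    HasDerivAt (fun z => Complex.log (z / 2)) (1 / z) z := by
  have hz0 : z ≠ 0 := fun h => by simp [h] at hz
  have h := ((hasDerivAt_id z).div_const 2).clog
    (Or.inl (by simpa using hz) : z / 2 ∈ Complex.slitPlane)
  refine h.congr_deriv ?_
  simp
  field_simp

theorem hasDerivAt_besselDefect {z : ℂ} (hz : 0 < z.re) :
    HasDerivAt besselDefect (besselDefectEuler z / z) z := by
  have hz0 : z ≠ 0 := fun h => by simp [h] at hz
  have h := ((hasDerivAt_laplaceMoment 0 hz).add (((hasDerivAt_log_half hz).mul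
    (entireCoeff_bessel.hasDerivAt_sq_div_four hz0)).add
    (entireCoeff_weber.hasDerivAt_sq_div_four hz0))).sub
    ((((hasDerivAt_id z).div_const 2).mul
      (entireCoeff_struve.hasDerivAt_sq_div_four hz0)).const_mul ((Real.pi : ℂ) / 2))
  refine h.congr_deriv ?_
  rw [besselDefectEuler]
  simp only [id]
  field_simp

theorem hasDerivAt_besselDefectEuler {z : ℂ} (hz : 0 < z.re) :
    HasDerivAt besselDefectEuler (-z * besselDefect z) z := by
  have hz0 : z ≠ 0 := fun h => by simp [h] at hz
  have hpi : (Real.pi : ℂ) ≠ 0 := by exact_mod_cast Real.pi_ne_zero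
  have h := (((hasDerivAt_id z).mul (hasDerivAt_laplaceMoment 1 hz)).add
    (((entireCoeff_bessel.hasDerivAt_sq_div_four hz0).add (((hasDerivAt_log_half hz).mul
    (entireCoeff_bessel.natCast_mul.hasDerivAt_sq_div_four hz0)).const_mul 2)).add
    ((entireCoeff_weber.natCast_mul.hasDerivAt_sq_div_four hz0).const_mul 2))).sub
    ((((hasDerivAt_id z).div_const 2).mul
      ((entireCoeff_struve.hasDerivAt_sq_div_four hz0).add
      ((entireCoeff_struve.natCast_mul.hasDerivAt_sq_div_four hz0).const_mul 2))).const_mul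
        ((Real.pi : ℂ) / 2))
  refine h.congr_deriv ?_
  have e1 := laplaceMoment_bessel_equation hz
  have e2 := powerSum_sq_besselCoeff (z ^ 2 / 4)
  have e3 := powerSum_sq_weberCoeff (z ^ 2 / 4)
  have e4 := powerSum_sq_struveCoeff (z ^ 2 / 4)
  rw [besselDefect]
  simp only [id, Pi.add_apply]
  have e4' : Real.pi * (powerSum struveCoeff (z ^ 2 / 4) +
      4 * powerSum (fun k => (k : ℂ) * struveCoeff k) (z ^ 2 / 4) +
      4 * powerSum (fun k => (k : ℂ) * (k * struveCoeff k)) (z ^ 2 / 4)) =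
        4 - Real.pi * (4 * (z ^ 2 / 4) * powerSum struveCoeff (z ^ 2 / 4)) := by
    rw [e4, mul_sub, mul_div_cancel₀ _ hpi]
  generalize powerSum (fun k => (k : ℂ) * (k * struveCoeff k)) (z ^ 2 / 4) = s2 at *
  generalize powerSum (fun k => (k : ℂ) * (k * weberCoeff k)) (z ^ 2 / 4) = b2 at *
  generalize powerSum (fun k => (k : ℂ) * (k * besselCoeff k)) (z ^ 2 / 4) = a2 at *
  generalize powerSum (fun k => (k : ℂ) * struveCoeff k) (z ^ 2 / 4) = s1 at *
  generalize powerSum (fun k => (k : ℂ) * weberCoeff k) (z ^ 2 / 4) = b1 at *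
  generalize powerSum (fun k => (k : ℂ) * besselCoeff k) (z ^ 2 / 4) = a1 at *
  generalize powerSum struveCoeff (z ^ 2 / 4) = s0 at *
  generalize powerSum weberCoeff (z ^ 2 / 4) = b0 at *
  generalize powerSum besselCoeff (z ^ 2 / 4) = a0 at *
  field_simp
  -- The inhomogeneities of the Laplace and Struve parts cancel here.
  linear_combination 4 * z * e1 + 16 * Complex.log (z / 2) * e2 + 16 * e3 - z * e4'

theorem EntireCoeff.tendsto_sq_div_four {c : ℕ → ℂ} (hc : EntireCoeff c) :
    Tendsto (fun x : ℝ => powerSum c ((x : ℂ) ^ 2 / 4)) (𝓝[>] 0) (𝓝 (c 0)) := by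
  have h : Continuous fun x : ℝ => powerSum c ((x : ℂ) ^ 2 / 4) :=
    hc.differentiable.continuous.comp (by fun_prop)
  have h0 := h.tendsto 0
  simp only [Complex.ofReal_zero, ne_eq, OfNat.ofNat_ne_zero, not_false_eq_true, zero_pow,
    zero_div, powerSum_zero] at h0
  exact h0.mono_left nhdsWithin_le_nhds

theorem tendsto_ofReal_div_two : Tendsto (fun x : ℝ => (x : ℂ) / 2) (𝓝[>] 0) (𝓝 0) := by
  have := (Complex.continuous_ofReal.div_const (2 : ℂ)).tendsto 0
  simp only [Complex.ofReal_zero, zero_div] at this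
  exact this.mono_left nhdsWithin_le_nhds

/-- The difference is (x/2)² times a bounded factor, which beats the logarithm. -/
theorem EntireCoeff.tendsto_log_mul_sub {c : ℕ → ℂ} (hc : EntireCoeff c) :
    Tendsto (fun x : ℝ => Complex.log ((x : ℂ) / 2) * (powerSum c ((x : ℂ) ^ 2 / 4) - c 0))
      (𝓝[>] 0) (𝓝 0) := by
  have h1 : Tendsto (fun x : ℝ => Real.log (x / 2) * (x / 2)) (𝓝[>] 0) (𝓝 0) := by
    have h : Tendsto (fun x : ℝ => x / 2) (𝓝[>] 0) (𝓝[>] 0) := by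
      refine tendsto_nhdsWithin_iff.2 ⟨?_, ?_⟩
      · have := (continuous_id.div_const (2 : ℝ)).tendsto 0
        simp only [id, zero_div] at this
        exact this.mono_left nhdsWithin_le_nhds
      · filter_upwards [self_mem_nhdsWithin] with x hx
        exact half_pos (mem_Ioi.1 hx)
    simpa [Function.comp_def] using (tendsto_log_mul_rpow_nhdsGT_zero one_pos).comp h
  have h2 := tendsto_ofReal_div_two
  have h3 := (((Complex.continuous_ofReal.tendsto _).comp h1).mul h2).mul
    hc.succ.tendsto_sq_div_four
  rw [Complex.ofReal_zero, zero_mul, zero_mul] at h3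
  refine h3.congr' ?_
  filter_upwards [self_mem_nhdsWithin] with x hx
  have hx' : 0 < x := hx
  rw [powerSum_eq_add_mul hc, Function.comp_apply]
  push_cast
  rw [Complex.ofReal_log (by positivity)]
  push_cast
  ring

theorem tendsto_besselDefect : Tendsto (fun x : ℝ => besselDefect x) (𝓝[>] 0) (𝓝 0) := by
  have h2 := tendsto_ofReal_div_two
  have h := ((tendsto_laplaceMoment_zero_add_log.add entireCoeff_bessel.tendsto_log_mul_sub).add
    entireCoeff_weber.tendsto_sq_div_four).sub
    ((h2.mul entireCoeff_struve.tendsto_sq_div_four).const_mul ((Real.pi : ℂ) / 2))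
  have e : -recipGammaDeriv 0 + 0 + weberCoeff 0 - (Real.pi : ℂ) / 2 * (0 * struveCoeff 0) = 0 := by
    simp [weberCoeff]
  rw [e] at h
  refine h.congr' ?_
  filter_upwards [self_mem_nhdsWithin] with x hx
  have hx' : 0 < x := hx
  have hb : besselCoeff 0 = 1 := by simp [besselCoeff]
  rw [besselDefect, Complex.ofReal_log (by positivity), hb]
  push_cast
  ring

/-- The limit -1 of xF'(x) cancels J_0(0) = 1, which comes from differentiating the logarithm. -/
theorem tendsto_besselDefectEuler :
    Tendsto (fun x : ℝ => besselDefectEuler x) (𝓝[>] 0) (𝓝 0) := by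
  have h2 := tendsto_ofReal_div_two
  have h := (tendsto_mul_laplaceMoment_one.add ((entireCoeff_bessel.tendsto_sq_div_four.add
    (entireCoeff_bessel.natCast_mul.tendsto_log_mul_sub.const_mul 2)).add
    (entireCoeff_weber.natCast_mul.tendsto_sq_div_four.const_mul 2))).sub
    ((h2.mul (entireCoeff_struve.tendsto_sq_div_four.add
      (entireCoeff_struve.natCast_mul.tendsto_sq_div_four.const_mul 2))).const_mul
        ((Real.pi : ℂ) / 2))
  simpa [besselDefectEuler, besselCoeff] using h

theorem besselDefect_eq_zero {z : ℂ} (hz : 0 < z.re) : besselDefect z = 0 := by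
  obtain ⟨δ, hδ, h⟩ := eq_zero_of_bessel_equation (D := fun x : ℝ => besselDefect x)
    (E := fun x : ℝ => besselDefectEuler x)
    (fun x hx => (hasDerivAt_besselDefect (z := x) (by simpa using hx)).comp_ofReal)
    (fun x hx => (hasDerivAt_besselDefectEuler (z := x) (by simpa using hx)).comp_ofReal)
    tendsto_besselDefect tendsto_besselDefectEuler
  have hU : IsOpen {z : ℂ | 0 < z.re} := isOpen_lt continuous_const Complex.continuous_re
  have hA : AnalyticOnNhd ℂ besselDefect {z : ℂ | 0 < z.re} :=
    DifferentiableOn.analyticOnNhd (fun v hv =>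
      (hasDerivAt_besselDefect hv).differentiableAt.differentiableWithinAt) hU
  have hc : IsPreconnected {z : ℂ | 0 < z.re} := (convex_halfSpace_re_gt 0).isPreconnected
  refine hA.eqOn_zero_of_preconnected_of_frequently_eq_zero hc (z₀ := ((δ / 2 : ℝ) : ℂ))
    (by simpa using hδ) ?_ hz
  have ht : Tendsto (fun x : ℝ => (x : ℂ)) (𝓝[≠] (δ / 2)) (𝓝[≠] ((δ / 2 : ℝ) : ℂ)) := by
    refine tendsto_nhdsWithin_iff.2
      ⟨(Complex.continuous_ofReal.tendsto _).mono_left nhdsWithin_le_nhds, ?_⟩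
    filter_upwards [self_mem_nhdsWithin] with x hx
    exact fun h => hx (Complex.ofReal_injective h)
  refine ht.frequently (Eventually.frequently ?_)
  filter_upwards [mem_nhdsWithin_of_mem_nhds
    (Ioo_mem_nhds (half_pos hδ) (half_lt_self hδ))] with x hx using h x hx

theorem weberStruve_eq {z : ℂ} (hz : 0 < z.re) :
    weberStruve z = -(2 / Real.pi) * laplaceMoment 0 z := by
  have hz0 : z ≠ 0 := fun h => by simp [h] at hz
  have hpi : (Real.pi : ℂ) ≠ 0 := by exact_mod_cast Real.pi_ne_zero
  have h := besselDefect_eq_zero hz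
  rw [besselDefect] at h
  rw [weberStruve, besselY_zero_eq hz0, struveH_zero_eq]
  field_simp at h ⊢
  linear_combination h

theorem iteratedDeriv_weberStruve (l : ℕ) {z : ℂ} (hz : 0 < z.re) :
    iteratedDeriv l weberStruve z = -(2 / Real.pi) * laplaceMoment l z := by
  have h : weberStruve =ᶠ[𝓝 z] fun v => -(2 / Real.pi) * laplaceMoment 0 v := by
    filter_upwards [(isOpen_lt continuous_const Complex.continuous_re).mem_nhds hz] with v hv
    exact weberStruve_eq hv
  rw [h.iteratedDeriv_eq, iteratedDeriv_const_mul_field, iteratedDeriv_laplaceMoment l hz]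

/-! ### Expansion of the Sobolev–Laguerre functions -/

theorem sqrt_laguerreWeight_div (ξ : ℝ) (hξ : 0 ≤ ξ) :
    √(laguerreWeight ξ / ∑ k ∈ Finset.range (1 + 1), ξ ^ (2 * k)) =
      Real.exp (-(1 / 2) * ξ) * (√(1 + ξ ^ 2))⁻¹ := by
  have h : √(Real.exp (-ξ)) = Real.exp (-(1 / 2) * ξ) := by
    rw [← Real.exp_half]
    congr 1
    ring
  rw [laguerreWeight, indicator_of_mem (by exact hξ), Real.sqrt_div (Real.exp_pos _).le, h,
    div_eq_mul_inv]
  simp [Finset.sum_range_succ]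

theorem sobolevLaguerre_eq_sum (n : ℕ) (x : ℝ) :
    sobolevLaguerre n x = Complex.I ^ n / (√(2 * Real.pi) : ℝ) *
      ∑ l ∈ Finset.range (n + 1), (n.choose l : ℂ) / l.factorial *
        laplaceMoment l (1 / 2 - Complex.I * x) := by
  have hz : 0 < (1 / 2 - Complex.I * x : ℂ).re := by simp
  rw [sobolevLaguerre, firstKind]
  congr 1
  have e1 : (∫ ξ : ℝ, Complex.exp (Complex.I * x * ξ) * ((laguerreSystem.poly n).eval ξ : ℝ) *
      (√(laguerreWeight ξ / ∑ k ∈ Finset.range (1 + 1), ξ ^ (2 * k)) : ℝ)) =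
      ∫ ξ in Ioi (0 : ℝ), ∑ l ∈ Finset.range (n + 1), (n.choose l : ℂ) / l.factorial *
        (momentWeight l ξ * Complex.exp (-(1 / 2 - Complex.I * x) * ξ)) := by
    rw [← integral_Ici_eq_integral_Ioi, ← integral_indicator measurableSet_Ici]
    refine integral_congr_ae (Eventually.of_forall fun ξ => ?_)
    by_cases hξ : ξ ∈ Ici (0 : ℝ)
    · simp only
      rw [indicator_of_mem hξ, sqrt_laguerreWeight_div ξ hξ]
      change _ * (((laguerrePoly n).eval ξ : ℝ) : ℂ) * _ = _
      have hexp : Complex.exp (-(1 / 2 - Complex.I * x) * ξ) =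
          Complex.exp (Complex.I * x * ξ) * (Real.exp (-(1 / 2) * ξ) : ℝ) := by
        push_cast
        rw [← Complex.exp_add]
        congr 1
        ring
      rw [laguerrePoly, Polynomial.eval_finsetSum, hexp]
      push_cast
      rw [Finset.mul_sum, Finset.sum_mul]
      refine Finset.sum_congr rfl fun l _ => ?_
      simp only [Polynomial.eval_mul, Polynomial.eval_C, Polynomial.eval_pow, Polynomial.eval_X,
        momentWeight, neg_pow (ξ : ℂ)]
      push_cast
      ring
    · simp only
      rw [indicator_of_notMem hξ, show laguerreWeight ξ = 0 from indicator_of_notMem hξ _]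
      simp
  rw [e1, integral_finsetSum _ fun l _ => (integrableOn_momentWeight l hz).const_mul _]
  exact Finset.sum_congr rfl fun l _ => integral_const_mul _ _

/-- The moment bound uses up one of the two factorials; the other leaves an exponential series. -/
theorem summable_laplaceMoment_series {z : ℂ} (hz : 0 < z.re) (s : ℂ) :
    Summable fun l : ℕ => ‖s ^ l / (l.factorial : ℂ) ^ 2 * laplaceMoment l z‖ := by
  refine Summable.of_nonneg_of_le (fun _ => norm_nonneg _) (fun l => ?_)
    ((Real.summable_pow_div_factorial (‖s‖ * (1 / z.re))).mul_left (1 / z.re))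
  have hf : (0 : ℝ) < l.factorial := by exact_mod_cast l.factorial_pos
  rw [norm_mul, norm_div, norm_pow, norm_pow, Complex.norm_natCast]
  refine (mul_le_mul_of_nonneg_left (norm_laplaceMoment_le l hz) (by positivity)).trans_eq ?_
  rw [mul_pow, pow_succ (1 / z.re)]
  field_simp

/-- Cauchy product form, from (n choose l)/(n! l!) = 1/((l!)² (n-l)!). -/
theorem sobolevLaguerre_term_eq (n : ℕ) (x : ℝ) (t : ℂ) :
    sobolevLaguerre n x / (n.factorial : ℂ) * t ^ n = 1 / (√(2 * Real.pi) : ℝ) *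
      ∑ kl ∈ Finset.HasAntidiagonal.antidiagonal n, (Complex.I * t) ^ kl.1 / (kl.1.factorial : ℂ) ^ 2 *
        laplaceMoment kl.1 (1 / 2 - Complex.I * x) *
          ((Complex.I * t) ^ kl.2 / (kl.2.factorial : ℂ)) := by
  rw [sobolevLaguerre_eq_sum, Finset.Nat.sum_antidiagonal_eq_sum_range_succ_mk, Finset.mul_sum,
    Finset.sum_div, Finset.sum_mul, Finset.mul_sum]
  refine Finset.sum_congr rfl fun l hl => ?_
  have hl' : l ≤ n := Nat.lt_succ_iff.1 (Finset.mem_range.1 hl)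
  have hp : (Complex.I * t) ^ l * (Complex.I * t) ^ (n - l) = Complex.I ^ n * t ^ n := by
    rw [← pow_add, Nat.add_sub_cancel' hl', mul_pow]
  have hf (k : ℕ) : (k.factorial : ℂ) ≠ 0 := by exact_mod_cast k.factorial_ne_zero
  have h1 := hf l
  have h2 := hf n
  have h3 := hf (n - l)
  rw [Nat.cast_choose ℂ hl']
  simp only
  calc _ = 1 / ((√(2 * Real.pi) : ℝ) : ℂ) * (Complex.I ^ n * t ^ n) /
        ((l.factorial : ℂ) ^ 2 * ((n - l).factorial : ℂ)) *
          laplaceMoment l (1 / 2 - Complex.I * x) := by field_simp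
    _ = _ := by
      rw [← hp]
      field_simp

end SobolevLaguerre

/-- In ℂ, `Summable` and `HasSum` are unconditional, hence encode absolute convergence. -/
theorem mainTheorem8 (x : ℝ) (t : ℂ) :
    Summable (fun l : ℕ => (Complex.I * t) ^ l / (l.factorial : ℂ) ^ 2 *
      iteratedDeriv l SobolevLaguerre.weberStruve (1 / 2 - Complex.I * x)) ∧
    HasSum (fun n : ℕ => SobolevLaguerre.sobolevLaguerre n x / (n.factorial : ℂ) * t ^ n)
      (-((√(2 * Real.pi) : ℝ) : ℂ) / 4 * Complex.exp (Complex.I * t) *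
        ∑' l : ℕ, (Complex.I * t) ^ l / (l.factorial : ℂ) ^ 2 *
          iteratedDeriv l SobolevLaguerre.weberStruve (1 / 2 - Complex.I * x)) := by
  have hz : 0 < (1 / 2 - Complex.I * x : ℂ).re := by simp
  have hs := SobolevLaguerre.summable_laplaceMoment_series hz (Complex.I * t)
  have hexp : Summable fun m : ℕ => ‖(Complex.I * t) ^ m / (m.factorial : ℂ)‖ :=
    NormedSpace.norm_expSeries_div_summable _
  have hterm : ∀ l : ℕ, (Complex.I * t) ^ l / (l.factorial : ℂ) ^ 2 *
      iteratedDeriv l SobolevLaguerre.weberStruve (1 / 2 - Complex.I * x) =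
      -(2 / Real.pi) * ((Complex.I * t) ^ l / (l.factorial : ℂ) ^ 2 *
        SobolevLaguerre.laplaceMoment l (1 / 2 - Complex.I * x)) := fun l => by
    rw [SobolevLaguerre.iteratedDeriv_weberStruve l hz]
    ring
  simp only [hterm]
  refine ⟨hs.of_norm.mul_left _, ?_⟩
  have hsum := (summable_norm_sum_mul_antidiagonal_of_summable_norm hs hexp).of_norm.hasSum
  rw [← tsum_mul_tsum_eq_tsum_sum_antidiagonal_of_summable_norm hs hexp] at hsum
  have hE : ∑' m : ℕ, (Complex.I * t) ^ m / (m.factorial : ℂ) = Complex.exp (Complex.I * t) := by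
    rw [Complex.exp_eq_exp_ℂ, NormedSpace.exp_eq_tsum_div]
  rw [hE] at hsum
  have h := hsum.mul_left (1 / ((√(2 * Real.pi) : ℝ) : ℂ))
  simp only [SobolevLaguerre.sobolevLaguerre_term_eq]
  have hq : ((√(2 * Real.pi) : ℝ) : ℂ) * ((√(2 * Real.pi) : ℝ) : ℂ) = 2 * Real.pi := by
    exact_mod_cast Real.mul_self_sqrt (by positivity)
  have hpi : (Real.pi : ℂ) ≠ 0 := by exact_mod_cast Real.pi_ne_zero
  have hq0 : ((√(2 * Real.pi) : ℝ) : ℂ) ≠ 0 := fun h0 => by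
    rw [h0, zero_mul] at hq
    exact mul_ne_zero two_ne_zero hpi hq.symm
  -- The prefactor √(2π)/4 is (π/2)/√(2π).
  have hc : -((√(2 * Real.pi) : ℝ) : ℂ) / 4 * -(2 / Real.pi) = 1 / ((√(2 * Real.pi) : ℝ) : ℂ) := by
    field_simp
    linear_combination 2 * hq
  have hval (S : ℂ) : -((√(2 * Real.pi) : ℝ) : ℂ) / 4 * Complex.exp (Complex.I * t) *
      (-(2 / Real.pi) * S) = 1 / ((√(2 * Real.pi) : ℝ) : ℂ) *
        (S * Complex.exp (Complex.I * t)) := by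
    rw [← hc]
    ring
  rw [tsum_mul_left, hval]
  exact h
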